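/- An arithmetic progression is a set $a\mathbb{Z}+b$ with $a,b\in\mathbb{N}$, $a\neq 0$. The upper and lower asymptotic densities $\bar d(A)$, $\underline d(A)$ of $A\subset\mathbb{Z}$ (or $A\subset\mathbb{N}$) are the upper and lower limits of $\frac1N\#(A\cap[0,N-1])$ as $N\to\infty$; if they agree, the common value is the asymptotic density $d(A)$. A set $A\subset\mathbb{Z}$ is rational if for every $\varepsilon>0$ there is a finite union $B$ of arithmetic progressions with $\bar d(A\,\triangle\,B)<\varepsilon$; a set $J\subset\mathbb{N}$ is rational if $J=C\cap\mathbb{N}$ for some rational $C\subset\mathbb{Z}$. For a continuous map $f$ of a compact metric space $X$ and $x\in X$, let $V(x)$ be the set of $f$-invariant Borel probability measures that are weak$^*$ limits of $\frac1{n_k}\sum_{i=0}^{n_k-1}\delta_{f^i(x)}$ along some strictly increasing sequence $(n_k)$ of positive integers; $x$ is generic for $\mu$ if $V(x)=\{\mu\}$. Let $\sigma$ be the shift on $\Omega_2=\{0,1\}^{\mathbb{Z}}$ and let $\xi_{1/2}$ be the Bernoulli measure on $\Omega_2$, that is, the product of the uniform measures on $\{0,1\}$. **Corollary.** Let $X$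 be a compact metric space and let $J\subset\mathbb{N}$ be a rational set. Then $J$ has an asymptotic density $d(J)$. Moreover, let $f\colon X\to X$ be continuous, let $K_0,K_1\subset X$ be disjoint compact sets, let $\bar x\in X$, and let $z\in\Omega_2$ be a generic point for $\xi_{1/2}$ (with respect to $\sigma$) such that $f^j(\bar x)\in K_{z(j)}$ for every $j\in J$. Then every $\mu\in V(\bar x)$ satisfies $$h_\mu(f)\ge d(J)\cdot\log 2,$$ where $h_\mu(f)$ is the Kolmogorov–Sinai entropy. If $d(J)>0$ (in particular if $0<d(J)<1$), then $h_\mu(f)>0$. -/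

import Mathlib

open MeasureTheory Filter Topology

namespace EntropyControl

noncomputable section

/-! ### Empirical measures, generated measures, generic points -/

section Generated

variable {X : Type*} [MeasurableSpace X]

/-- The measure `(1/n) ∑_{i<n} δ_{f^i(x)}`. -/
def empirical (f : X → X) (x : X) (n : ℕ+) : Measure X :=
  ((n : ℕ) : ENNReal)⁻¹ • ∑ i ∈ Finset.range n, Measure.dirac (f^[i] x)

instance empirical_isProbabilityMeasure (f : X → X) (x : X) (n : ℕ+) :
    IsProbabilityMeasure (empirical f x n) := by
  constructor
  simp only [empirical, Measure.smul_apply, Measure.finsetSum_apply, measure_univ,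
    Finset.sum_const, Finset.card_range, smul_eq_mul, nsmul_eq_mul, mul_one]
  exact ENNReal.inv_mul_cancel (by exact_mod_cast n.ne_zero) (ENNReal.natCast_ne_top _)

/-- The empirical measure as a point of the space of probability measures. -/
def empiricalProb (f : X → X) (x : X) (n : ℕ+) : ProbabilityMeasure X :=
  ⟨empirical f x n, inferInstance⟩

variable [TopologicalSpace X] [OpensMeasurableSpace X]

/-- `V(x)`: the `f`-invariant Borel probability measures `μ` which are generated by `x`, that is,
the empirical measures of `x` converge to `μ` weak* along some strictly increasing sequence
of positive integers. -/
def generatedMeasures (f : X → X) (x : X) : Set (ProbabilityMeasure X) :=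
  {μ | MeasurePreserving f (μ : Measure X) (μ : Measure X) ∧
    ∃ n : ℕ → ℕ+, StrictMono n ∧
      Tendsto (fun k => empiricalProb f x (n k)) atTop (𝓝 μ)}

/-- `x` is a generic point for `μ`: it generates `μ` and nothing else. -/
def IsGenericPoint (f : X → X) (x : X) (μ : ProbabilityMeasure X) : Prop :=
  generatedMeasures f x = {μ}

end Generated

/-! ### Kolmogorov-Sinai entropy -/

section Entropy

variable {X : Type*} [MeasurableSpace X]

/-- Shannon entropy `-∑ μ(P_i) log μ(P_i)` of the finite partition `P_i = ξ⁻¹{i}`. -/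
def partitionEntropy {ι : Type*} [Fintype ι] (μ : Measure X) (ξ : X → ι) : ℝ :=
  ∑ i, Real.negMulLog (μ.real (ξ ⁻¹' {i}))

/-- The labelling of the common refinement of the partitions
`ξ, f⁻¹ ξ, …, f^{-(n-1)} ξ`. -/
def refine {ι : Type*} (f : X → X) (ξ : X → ι) (n : ℕ) : X → (Fin n → ι) :=
  fun x i => ξ (f^[i] x)

/-- Entropy of `f` with respect to a finite partition. (For invariant `μ` and measurable `ξ` the
limit exists, so the upper limit is the limit.) -/
def entropyOfPartition {ι : Type*} [Fintype ι] (f : X → X) (μ : Measure X) (ξ : X → ι) : EReal :=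
  limsup (fun n : ℕ => ((partitionEntropy μ (refine f ξ n) / n : ℝ) : EReal)) atTop

/-- The entropy `h_μ(f)`: the supremum over all finite measurable partitions, a partition into
`k` (possibly empty) measurable sets being given by a measurable labelling `X → Fin k`. -/
def ksEntropy (f : X → X) (μ : Measure X) : EReal :=
  ⨆ (k : ℕ) (ξ : X → Fin k) (_ : Measurable ξ), entropyOfPartition f μ ξ

end Entropy

/-! ### Densities and rational sets -/

/-- The upper asymptotic density `limsup_N (1/N) #(J ∩ [0, N-1])`. -/
def upperDensity (J : Set ℕ) : ℝ :=
  limsup (fun N : ℕ => ((J ∩ Set.Iio N).ncard : ℝ) / N) atTop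

/-- The lower asymptotic density `liminf_N (1/N) #(J ∩ [0, N-1])`. -/
def lowerDensity (J : Set ℕ) : ℝ :=
  liminf (fun N : ℕ => ((J ∩ Set.Iio N).ncard : ℝ) / N) atTop

/-- `J` has asymptotic density `d`. -/
def HasDensity (J : Set ℕ) (d : ℝ) : Prop :=
  lowerDensity J = d ∧ upperDensity J = d

/-- `A ∩ ℕ`, as a set of natural numbers. -/
def natPart (A : Set ℤ) : Set ℕ := {n | (n : ℤ) ∈ A}

/-- Arithmetic progressions `aℤ + b` with `a, b ∈ ℕ`, `a ≠ 0`. -/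
def IsArithProg (P : Set ℤ) : Prop :=
  ∃ a b : ℕ, a ≠ 0 ∧ P = {m : ℤ | ∃ k : ℤ, m = a * k + b}

/-- Unions of finitely many arithmetic progressions. -/
def IsFiniteUnionAP (B : Set ℤ) : Prop :=
  ∃ S : Set (Set ℤ), S.Finite ∧ (∀ P ∈ S, IsArithProg P) ∧ B = ⋃₀ S

/-- Rational sets of integers. Upper density of a set of integers only sees its part in `ℕ`. -/
def IsRationalInt (A : Set ℤ) : Prop :=
  ∀ ε : ℝ, 0 < ε → ∃ B : Set ℤ, IsFiniteUnionAP B ∧ upperDensity (natPart (symmDiff A B)) < ε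

/-- Rational sets of natural numbers. -/
def IsRationalNat (J : Set ℕ) : Prop :=
  ∃ C : Set ℤ, IsRationalInt C ∧ J = natPart C

/-! ### The two-sided full shift on two symbols and the Bernoulli measure -/

/-- The shift `(σ ω)_i = ω_{i+1}` on `{0,1}^ℤ`. -/
def shift (ω : ℤ → Fin 2) : ℤ → Fin 2 := fun i => ω (i + 1)

/-- The Bernoulli measure `ξ_{1/2}`: the product over `ℤ` of the uniform measure on `{0,1}`. -/
def bernoulliHalf : ProbabilityMeasure (ℤ → Fin 2) :=
  ⟨Measure.infinitePi fun _ : ℤ => (PMF.uniformOfFintype (Fin 2)).toMeasure, inferInstance⟩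

end

end EntropyControl

namespace EntropyControl

noncomputable section

/-! ### Frequencies along initial segments of `ℕ` -/

/-! The heart is a coding argument. Let `p` be the itinerary of the orbit through a two-set
partition separating `K 0` from `K 1`; it agrees with `z` on `J`. An `n`-word of `z` at time `i` is
recovered from the `n`-word of `p` at `i` once one knows which sites lie in `J` and what `z` is at
the others. Since `J` is close to a `q`-periodic set `B`, its pattern is described by `i % q`, at
cost `log q` once per word, plus corrections at the rare sites where `J` and `B` differ; each site
outside `J` costs `log 2`. This is `seqEntropy_words_le`, proved from Gibbs' inequality
`seqEntropy_comp_le`.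

Genericity gives the words of `z` entropy `n * log 2` in the limit
(`exists_subseq_tendsto_seqEntropy`). The partition is chosen with `μ`-null boundary, so the word
entropies of `p` converge to those of `μ`. The word entropy of `μ` is then at least `n * (d * log 2
- η) - log q`; dividing by `n` removes `log q`. The density exists because frequencies in `J` are
uniformly close, for large `N`, to the convergent frequencies of a periodic set. -/

/-- The relative frequency of `A` in `[0, N)`. -/
def freq (A : Set ℕ) (N : ℕ) : ℝ := (∑ i ∈ Finset.range N, A.indicator 1 i) / N

lemma ncard_inter_Iio (A : Set ℕ) (N : ℕ) :
    ((A ∩ Set.Iio N).ncard : ℝ) = ∑ i ∈ Finset.range N, A.indicator 1 i := by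
  classical
  have : A ∩ Set.Iio N = ↑((Finset.range N).filter (· ∈ A)) := by
    ext i; simp [and_comm]
  rw [this, Set.ncard_coe_finset, Finset.card_filter]
  push_cast
  exact Finset.sum_congr rfl fun i _ => by simp [Set.indicator_apply]

lemma freq_eq_ncard (A : Set ℕ) (N : ℕ) : freq A N = ((A ∩ Set.Iio N).ncard : ℝ) / N := by
  rw [freq, ncard_inter_Iio]

lemma freq_nonneg (A : Set ℕ) (N : ℕ) : 0 ≤ freq A N :=
  div_nonneg (Finset.sum_nonneg fun i _ => Set.indicator_nonneg (fun _ _ => zero_le_one) i)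
    N.cast_nonneg

lemma indicator_le_one' (A : Set ℕ) (i : ℕ) : A.indicator (1 : ℕ → ℝ) i ≤ 1 :=
  Set.indicator_le_self' (fun _ _ => zero_le_one) i

lemma freq_le_one (A : Set ℕ) (N : ℕ) : freq A N ≤ 1 := by
  refine div_le_one_of_le₀ ?_ N.cast_nonneg
  calc _ ≤ ∑ i ∈ Finset.range N, (1 : ℝ) := Finset.sum_le_sum fun i _ => indicator_le_one' A i
    _ = N := by simp

lemma freq_compl (A : Set ℕ) {N : ℕ} (hN : 0 < N) : freq Aᶜ N = 1 - freq A N := by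
  have h : (∑ i ∈ Finset.range N, Aᶜ.indicator (1 : ℕ → ℝ) i) =
      N - ∑ i ∈ Finset.range N, A.indicator 1 i := by
    rw [eq_sub_iff_add_eq, ← Finset.sum_add_distrib]
    have : ∀ i, Aᶜ.indicator (1 : ℕ → ℝ) i + A.indicator 1 i = 1 := fun i => by
      rw [Set.indicator_compl_add_self_apply]; rfl
    simp [this]
  rw [freq, freq, h]
  field_simp

lemma freq_mono {A B : Set ℕ} (h : A ⊆ B) (N : ℕ) : freq A N ≤ freq B N := by
  refine div_le_div_of_nonneg_right (Finset.sum_le_sum fun i _ => ?_) N.cast_nonneg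
  exact Set.indicator_le_indicator_of_subset h (fun _ => zero_le_one) i

lemma freq_symmDiff (A B : Set ℕ) (N : ℕ) : |freq A N - freq B N| ≤ freq (symmDiff A B) N := by
  unfold freq
  rw [← sub_div, ← Finset.sum_sub_distrib, abs_div, abs_of_nonneg (N.cast_nonneg : (0 : ℝ) ≤ N)]
  gcongr
  refine (Finset.abs_sum_le_sum_abs _ _).trans (Finset.sum_le_sum fun i _ => ?_)
  by_cases hA : i ∈ A <;> by_cases hB : i ∈ B <;>
    simp [hA, hB, Set.mem_symmDiff]

lemma freq_shift_le (A : Set ℕ) (N l : ℕ) : freq {i | i + l ∈ A} N ≤ freq A N + l / N := by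
  unfold freq
  rw [← add_div]
  gcongr
  have h1 : ∑ i ∈ Finset.range N, {i | i + l ∈ A}.indicator (1 : ℕ → ℝ) i =
      ∑ i ∈ Finset.range N, A.indicator (1 : ℕ → ℝ) (l + i) :=
    Finset.sum_congr rfl fun i _ => by rw [add_comm l i]; rfl
  have h2 := Finset.sum_range_add (A.indicator (1 : ℕ → ℝ)) l N
  have h3 := Finset.sum_range_add (A.indicator (1 : ℕ → ℝ)) N l
  have h4 : ∑ i ∈ Finset.range l, A.indicator (1 : ℕ → ℝ) (N + i) ≤ l :=
    (Finset.sum_le_sum fun i _ => indicator_le_one' A (N + i)).trans (by simp)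
  have h5 : 0 ≤ ∑ i ∈ Finset.range l, A.indicator (1 : ℕ → ℝ) i :=
    Finset.sum_nonneg fun i _ => Set.indicator_nonneg (fun _ _ => zero_le_one) i
  rw [add_comm N l] at h3
  linarith

/-! ### Entropy of the empirical distribution of a sequence -/

/-- Shannon entropy of the distribution of `a 0, …, a (N - 1)`. -/
def seqEntropy {κ : Type*} [Fintype κ] (a : ℕ → κ) (N : ℕ) : ℝ :=
  ∑ c, Real.negMulLog (freq {i | a i = c} N)

lemma sum_freq_mul {κ : Type*} [Fintype κ] (a : ℕ → κ) (N : ℕ) (φ : κ → ℝ) :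
    ∑ c, freq {i | a i = c} N * φ c = (∑ i ∈ Finset.range N, φ (a i)) / N := by
  classical
  simp only [freq, div_mul_eq_mul_div, Finset.sum_mul]
  rw [← Finset.sum_div, Finset.sum_comm]
  congr 1
  refine Finset.sum_congr rfl fun i _ => ?_
  simp [Set.indicator_apply]

/-- Entropy as a time average of surprisals, so that coding costs can be bounded time by time and
summed. -/
lemma seqEntropy_eq {κ : Type*} [Fintype κ] (a : ℕ → κ) (N : ℕ) :
    seqEntropy a N = (∑ i ∈ Finset.range N, -Real.log (freq {j | a j = a i} N)) / N := by
  rw [← sum_freq_mul a N fun c => -Real.log (freq {j | a j = c} N), seqEntropy]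
  exact Finset.sum_congr rfl fun c _ => by rw [Real.negMulLog]; ring

lemma freq_apply_pos {κ : Type*} (a : ℕ → κ) {N i : ℕ} (hi : i < N) :
    0 < freq {j | a j = a i} N := by
  refine div_pos ?_ (by exact_mod_cast (Nat.zero_le i).trans_lt hi)
  refine Finset.sum_pos' (fun i _ => Set.indicator_nonneg (fun _ _ => zero_le_one) i)
    ⟨i, Finset.mem_range.2 hi, by simp⟩

/-- Gibbs' inequality: a function of a sequence has entropy at most the cross entropy of the
sequence relative to any subprobability vector. -/
lemma seqEntropy_comp_le {τ ζ : Type*} [Fintype τ] [Fintype ζ] (T : ℕ → τ) (g : τ → ζ)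
    (Q : τ → ℝ) (hQ : ∀ t, 0 ≤ Q t) (hsum : ∑ t, Q t ≤ 1) {N : ℕ} (hN : 0 < N)
    (hpos : ∀ i < N, 0 < Q (T i)) :
    seqEntropy (fun i => g (T i)) N ≤ (∑ i ∈ Finset.range N, -Real.log (Q (T i))) / N := by
  have hN' : (0 : ℝ) < N := by exact_mod_cast hN
  set p : ζ → ℝ := fun c => freq {j | g (T j) = c} N with hp
  have hp0 : ∀ c, 0 ≤ p c := fun c => freq_nonneg _ _
  rw [seqEntropy_eq, ← sub_nonpos, ← sub_div, ← Finset.sum_sub_distrib]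
  have h1 : ∀ i ∈ Finset.range N,
      -Real.log (p (g (T i))) - -Real.log (Q (T i)) ≤ Q (T i) / p (g (T i)) - 1 := by
    intro i hi
    have hi := Finset.mem_range.1 hi
    have hpi : 0 < p (g (T i)) := freq_apply_pos (fun i => g (T i)) hi
    have := Real.log_le_sub_one_of_pos (div_pos (hpos i hi) hpi)
    rw [Real.log_div (hpos i hi).ne' hpi.ne'] at this
    linarith
  -- Grouping times by the value `t`, the frequency of `t` is at most `p (g t)`, so each `t`
  -- contributes at most `Q t`.
  have h2 : (∑ i ∈ Finset.range N, Q (T i) / p (g (T i))) / N ≤ 1 := by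
    rw [← sum_freq_mul T N fun t => Q t / p (g t)]
    refine (Finset.sum_le_sum fun t _ => ?_).trans hsum
    have h3 : freq {i | T i = t} N ≤ p (g t) :=
      freq_mono (fun i (hi : T i = t) => by simp [hi]) N
    rw [mul_div_left_comm]
    exact mul_le_of_le_one_right (hQ t) (div_le_one_of_le₀ h3 (hp0 _))
  calc _ ≤ (∑ i ∈ Finset.range N, (Q (T i) / p (g (T i)) - 1)) / N := by
        exact div_le_div_of_nonneg_right (Finset.sum_le_sum h1) hN'.le
    _ = (∑ i ∈ Finset.range N, Q (T i) / p (g (T i))) / N - 1 := by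
        rw [Finset.sum_sub_distrib, sub_div]
        simp [hN'.ne']
    _ ≤ 0 := by linarith

/-! ### Control of one symbolic sequence by another -/

/-- Weights of the three states `none`, `some 0`, `some 1` of a site, depending on whether `none`
is the expected state. -/
def siteWeight (δ : ℝ) (b : Prop) (s : Option (Fin 2)) : ℝ :=
  open Classical in
  (if (s = none ↔ b) then 1 - δ else δ) * (if s = none then 1 else 2⁻¹)

lemma siteWeight_pos {δ : ℝ} (h0 : 0 < δ) (h1 : δ < 1) (b : Prop) (s : Option (Fin 2)) :
    0 < siteWeight δ b s := by
  unfold siteWeight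
  have := sub_pos.2 h1
  split_ifs <;> positivity

lemma sum_siteWeight (δ : ℝ) (b : Prop) : ∑ s, siteWeight δ b s = 1 := by
  by_cases hb : b <;> simp [siteWeight, hb, Fintype.sum_option] <;> ring

/-- The price of one site: `log 2` for a symbol written out, `-log δ` for a wrong prediction by `b`,
and `-log (1 - δ)` charged everywhere to cover correct ones. -/
lemma neg_log_siteWeight_le {δ : ℝ} (h0 : 0 < δ) (h1 : δ < 1) (b : Prop) (s : Option (Fin 2))
    {A E : Set ℕ} {i : ℕ} (hA : s ≠ none → i ∈ A) (hE : ¬ (s = none ↔ b) → i ∈ E) :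
    -Real.log (siteWeight δ b s) ≤ A.indicator 1 i * Real.log 2 +
      E.indicator 1 i * (-Real.log δ) + (-Real.log (1 - δ)) := by
  have hd : 0 < 1 - δ := sub_pos.2 h1
  have l0 : 0 ≤ -Real.log δ := by linarith [Real.log_neg h0 h1]
  have l1 : 0 ≤ -Real.log (1 - δ) := by linarith [Real.log_neg hd (by linarith)]
  have l2 : 0 ≤ Real.log 2 := Real.log_nonneg one_le_two
  have hA0 : 0 ≤ A.indicator (1 : ℕ → ℝ) i := Set.indicator_nonneg (fun _ _ => zero_le_one) i
  have hE0 : 0 ≤ E.indicator (1 : ℕ → ℝ) i := Set.indicator_nonneg (fun _ _ => zero_le_one) i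
  unfold siteWeight
  rw [Real.log_mul (by split_ifs <;> positivity) (by split_ifs <;> positivity), neg_add, add_assoc,
    add_comm]
  refine add_le_add ?_ ?_
  · split_ifs with h
    · simpa using mul_nonneg hA0 l2
    · simp [hA h]
  · split_ifs with h
    · have := mul_nonneg hE0 l0
      linarith
    · simp [hE h, l1]

/-- If two sequences of symbols agree on `J`, then the `n`-words of the first have entropy
bounded by that of the `n`-words of the second, up to a term governed by the frequency of the
complement of `J` and the distance from `J` to a periodic set `B`. -/
lemma seqEntropy_words_le (z p : ℕ → Fin 2) (J B : Set ℕ) (hJ : ∀ j ∈ J, p j = z j)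
    {q : ℕ} (hq : 0 < q) (hB : ∀ m, m ∈ B ↔ m % q ∈ B) {δ : ℝ} (h0 : 0 < δ) (h1 : δ < 1)
    (n : ℕ) {N : ℕ} (hN : 0 < N) :
    seqEntropy (fun i (l : Fin n) => z (i + l)) N ≤
      seqEntropy (fun i (l : Fin n) => p (i + l)) N + Real.log q +
      n * ((1 - freq J N + n / N) * Real.log 2 +
        (freq (symmDiff J B) N + n / N) * (-Real.log δ) + (-Real.log (1 - δ))) := by
  classical
  have hN' : (0 : ℝ) < N := by exact_mod_cast hN
  have hq' : (0 : ℝ) < q := by exact_mod_cast hq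
  set P : (Fin n → Fin 2) → ℝ := fun w => freq {i | (fun l : Fin n => p (i + l)) = w} N with hP
  -- Side information: `none` means that the symbol can be copied from `p`.
  set S : ℕ → Fin n → Option (Fin 2) := fun i l => if i + l ∈ J then none else some (z (i + l))
    with hS
  let T : ℕ → (Fin n → Fin 2) × Fin q × (Fin n → Option (Fin 2)) :=
    fun i => (fun l => p (i + l), ⟨i % q, Nat.mod_lt _ hq⟩, S i)
  -- The model probability of a code: the empirical law of the `p`-words, the uniform law on
  -- residues and, given the residue, independent sites whose expected state is read off from `B`.
  let Q : (Fin n → Fin 2) × Fin q × (Fin n → Option (Fin 2)) → ℝ :=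
    fun t => P t.1 * ((q : ℝ)⁻¹ * ∏ l : Fin n, siteWeight δ ((t.2.1 : ℕ) + (l : ℕ) ∈ B) (t.2.2 l))
  let g : (Fin n → Fin 2) × Fin q × (Fin n → Option (Fin 2)) → (Fin n → Fin 2) :=
    fun t l => (t.2.2 l).getD (t.1 l)
  have hg : (fun i (l : Fin n) => z (i + l)) = fun i => g (T i) := by
    funext i l
    simp only [g, T, hS]
    split_ifs with h
    · simp [hJ _ h]
    · simp
  have hPsum : ∑ w, P w = 1 := by
    have := sum_freq_mul (fun i (l : Fin n) => p (i + l)) N fun _ => 1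
    simpa [hN'.ne', hP] using this
  have hPpos : ∀ i < N, 0 < P fun l => p (i + l) := fun i hi =>
    freq_apply_pos (fun i (l : Fin n) => p (i + l)) hi
  have hprod : ∀ (r : Fin q) (s : Fin n → Option (Fin 2)),
      0 < ∏ l : Fin n, siteWeight δ ((r : ℕ) + (l : ℕ) ∈ B) (s l) := fun r s =>
    Finset.prod_pos fun l _ => siteWeight_pos h0 h1 _ _
  have hsum : ∑ t, Q t ≤ 1 := by
    simp only [Q, Fintype.sum_prod_type, ← Finset.mul_sum]
    have : ∀ r : Fin q, ∑ s : Fin n → Option (Fin 2),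
        ∏ l : Fin n, siteWeight δ ((r : ℕ) + (l : ℕ) ∈ B) (s l) = 1 := fun r => by
      rw [← Fintype.prod_sum fun (l : Fin n) s => siteWeight δ ((r : ℕ) + (l : ℕ) ∈ B) s]
      simp only [sum_siteWeight, Finset.prod_const_one]
    simp [this, hPsum, hq'.ne']
  rw [hg]
  refine (seqEntropy_comp_le T g Q (fun t => mul_nonneg (freq_nonneg _ _)
    (mul_nonneg (by positivity) (hprod _ _).le)) hsum hN fun i hi => mul_pos (hPpos i hi)
    (mul_pos (by positivity) (hprod _ _))).trans ?_
  have hterm : ∀ i ∈ Finset.range N, -Real.log (Q (T i)) ≤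
      -Real.log (P fun l => p (i + l)) + Real.log q +
      ∑ l : Fin n, ({i | i + (l : ℕ) ∈ Jᶜ}.indicator 1 i * Real.log 2 +
      {i | i + (l : ℕ) ∈ symmDiff J B}.indicator 1 i * (-Real.log δ) + (-Real.log (1 - δ))) := by
    intro i hi
    have hi := Finset.mem_range.1 hi
    simp only [Q, T]
    rw [Real.log_mul (hPpos i hi).ne' (mul_pos (inv_pos.2 hq')
        (hprod ⟨i % q, Nat.mod_lt _ hq⟩ (S i))).ne',
      Real.log_mul (by positivity) (hprod ⟨i % q, Nat.mod_lt _ hq⟩ (S i)).ne', Real.log_inv,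
      Real.log_prod fun l _ => (siteWeight_pos h0 h1 _ _).ne', neg_add, neg_add, neg_neg,
      ← add_assoc, ← Finset.sum_neg_distrib]
    gcongr with l
    -- By periodicity the residue alone gives the prediction, so it fails only on `symmDiff J B`.
    have hl : i % q + l ∈ B ↔ i + l ∈ B := by rw [hB, hB (i + l), Nat.mod_add_mod]
    refine neg_log_siteWeight_le h0 h1 _ _ ?_ ?_
    · intro h
      by_contra h'
      exact h (by simpa [hS] using h')
    · have : S i l = none ↔ i + l ∈ J := by simp [hS]
      rw [hl, this]
      intro h
      simp only [Set.mem_ofPred_eq, Set.mem_symmDiff]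
      tauto
  have hl2 : 0 ≤ Real.log 2 := Real.log_nonneg one_le_two
  have hld : 0 ≤ -Real.log δ := by linarith [Real.log_neg h0 h1]
  calc _ ≤ (∑ i ∈ Finset.range N, (-Real.log (P fun l => p (i + l)) + Real.log q +
      ∑ l : Fin n, ({i | i + (l : ℕ) ∈ Jᶜ}.indicator 1 i * Real.log 2 +
      {i | i + (l : ℕ) ∈ symmDiff J B}.indicator 1 i * (-Real.log δ) +
        (-Real.log (1 - δ))))) / N := by
        exact div_le_div_of_nonneg_right (Finset.sum_le_sum hterm) hN'.le
    _ = seqEntropy (fun i (l : Fin n) => p (i + l)) N + Real.log q +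
      ∑ l : Fin n, (freq {i | i + (l : ℕ) ∈ Jᶜ} N * Real.log 2 +
        freq {i | i + (l : ℕ) ∈ symmDiff J B} N * (-Real.log δ) + (-Real.log (1 - δ))) := by
        rw [seqEntropy_eq, Finset.sum_add_distrib, Finset.sum_add_distrib, Finset.sum_comm,
          add_div, add_div]
        congr 1
        · simp [hN'.ne', hP]
        · rw [Finset.sum_div]
          refine Finset.sum_congr rfl fun l _ => ?_
          rw [Finset.sum_add_distrib, Finset.sum_add_distrib, ← Finset.sum_mul, ← Finset.sum_mul,
            freq, freq, Finset.sum_const, Finset.card_range, nsmul_eq_mul]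
          field_simp
    _ ≤ seqEntropy (fun i (l : Fin n) => p (i + l)) N + Real.log q +
      ∑ l : Fin n, ((1 - freq J N + n / N) * Real.log 2 +
        (freq (symmDiff J B) N + n / N) * (-Real.log δ) + (-Real.log (1 - δ))) := by
        gcongr with l _ l _
        · refine (freq_shift_le _ _ _).trans ?_
          rw [freq_compl J hN]
          gcongr
          exact l.2.le
        · refine (freq_shift_le _ _ _).trans ?_
          gcongr
          exact l.2.le
    _ = _ := by rw [Finset.sum_const, Finset.card_univ, Fintype.card_fin, nsmul_eq_mul]

/-! ### Rational sets have a density -/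

lemma isBoundedUnder_le_freq (A : Set ℕ) : IsBoundedUnder (· ≤ ·) atTop (freq A) :=
  isBoundedUnder_of ⟨1, freq_le_one A⟩

lemma upperDensity_eq (A : Set ℕ) : upperDensity A = limsup (freq A) atTop := by
  simp only [upperDensity, ← freq_eq_ncard]

lemma lowerDensity_eq (A : Set ℕ) : lowerDensity A = liminf (freq A) atTop := by
  simp only [lowerDensity, ← freq_eq_ncard]

lemma hasDensity_of_tendsto {A : Set ℕ} {d : ℝ} (h : Tendsto (freq A) atTop (𝓝 d)) :
    HasDensity A d :=
  ⟨by rw [lowerDensity_eq, h.liminf_eq], by rw [upperDensity_eq, h.limsup_eq]⟩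

lemma IsArithProg.exists_period {P : Set ℤ} (h : IsArithProg P) :
    ∃ q : ℕ, 0 < q ∧ ∀ m : ℤ, m + q ∈ P ↔ m ∈ P := by
  obtain ⟨a, b, ha, rfl⟩ := h
  refine ⟨a, Nat.pos_of_ne_zero ha, fun m => ⟨?_, ?_⟩⟩
  · rintro ⟨k, hk⟩
    exact ⟨k - 1, by linear_combination hk⟩
  · rintro ⟨k, hk⟩
    exact ⟨k + 1, by linear_combination hk⟩

lemma mem_add_mul_iff {P : Set ℤ} {q : ℕ} (h : ∀ m : ℤ, m + q ∈ P ↔ m ∈ P) (k : ℕ) (m : ℤ) :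
    m + (q * k : ℕ) ∈ P ↔ m ∈ P := by
  induction k with
  | zero => simp
  | succ k ih =>
    rw [← ih, ← h (m + (q * k : ℕ))]
    push_cast
    ring_nf

lemma IsFiniteUnionAP.exists_period {B : Set ℤ} (h : IsFiniteUnionAP B) :
    ∃ q : ℕ, 0 < q ∧ ∀ m : ℕ, m ∈ natPart B ↔ m % q ∈ natPart B := by
  obtain ⟨S, hfin, hS, rfl⟩ := h
  suffices ∃ q : ℕ, 0 < q ∧ ∀ m : ℤ, m + q ∈ ⋃₀ S ↔ m ∈ ⋃₀ S by
    obtain ⟨q, hq, h⟩ := this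
    refine ⟨q, hq, fun m => ?_⟩
    have := mem_add_mul_iff h (m / q) ((m % q : ℕ) : ℤ)
    rw [← Nat.cast_add, Nat.mod_add_div] at this
    exact this
  induction S, hfin using Set.Finite.induction_on with
  | empty => exact ⟨1, one_pos, by simp⟩
  | @insert P S _ _ ih =>
    obtain ⟨q₁, h₁, hP⟩ := (hS P (Set.mem_insert _ _)).exists_period
    obtain ⟨q₂, h₂, hU⟩ := ih fun P hP => hS P (Set.mem_insert_of_mem _ hP)
    -- A common multiple of the two periods is a period of the union.
    refine ⟨q₁ * q₂, Nat.mul_pos h₁ h₂, fun m => ?_⟩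
    rw [Set.sUnion_insert, Set.mem_union, Set.mem_union, mem_add_mul_iff hP, mul_comm q₁,
      mem_add_mul_iff hU]

/-- Full periods contribute exactly the mean `s q / q`; the incomplete last one shifts the frequency
by at most `q / N`. -/
lemma exists_tendsto_freq_of_periodic {B : Set ℕ} {q : ℕ} (hq : 0 < q)
    (hB : ∀ m, m ∈ B ↔ m % q ∈ B) : ∃ d, Tendsto (freq B) atTop (𝓝 d) := by
  have hq' : (0 : ℝ) < q := by exact_mod_cast hq
  set s : ℕ → ℝ := fun N => ∑ i ∈ Finset.range N, B.indicator 1 i with hs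
  have hper : ∀ i, B.indicator (1 : ℕ → ℝ) (q + i) = B.indicator 1 i := fun i => by
    classical
    have : q + i ∈ B ↔ i ∈ B := by rw [hB, hB i, Nat.add_mod_left]
    simp only [Set.indicator_apply, this, Pi.one_apply]
  have hstep : ∀ N, s (q + N) = s q + s N := fun N => by
    simp only [hs, Finset.sum_range_add, hper]
  have hmul : ∀ k N, s (q * k + N) = k * s q + s N := fun k N => by
    induction k with
    | zero => simp
    | succ k ih =>
      rw [mul_add_one, add_comm _ q, add_assoc, hstep, ih]
      push_cast
      ring
  refine ⟨s q / q, ?_⟩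
  have h0 : ∀ N, 0 ≤ s N := fun N =>
    Finset.sum_nonneg fun i _ => Set.indicator_nonneg (fun _ _ => zero_le_one) i
  have h1 : ∀ N, s N ≤ N := fun N =>
    (Finset.sum_le_sum fun i _ => indicator_le_one' B i).trans (by simp)
  rw [tendsto_iff_norm_sub_tendsto_zero]
  refine squeeze_zero' (Eventually.of_forall fun _ => norm_nonneg _) ?_
    (tendsto_const_div_atTop_nhds_zero_nat (q : ℝ))
  filter_upwards [eventually_gt_atTop 0] with N hN
  have hN' : (0 : ℝ) < N := by exact_mod_cast hN
  have hdecomp := hmul (N / q) (N % q)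
  rw [Nat.div_add_mod] at hdecomp
  have hN2 : (N : ℝ) = q * (N / q : ℕ) + (N % q : ℕ) := by exact_mod_cast (Nat.div_add_mod N q).symm
  have hr : ((N % q : ℕ) : ℝ) ≤ q := by exact_mod_cast (Nat.mod_lt N hq).le
  have hr0 : (0 : ℝ) ≤ (N % q : ℕ) := Nat.cast_nonneg _
  have key : freq B N - s q / q = (s (N % q) - (N % q : ℕ) * (s q / q)) / N := by
    rw [freq]
    change s N / N - _ = _
    rw [hdecomp, eq_div_iff hN'.ne', sub_mul, div_mul_cancel₀ _ hN'.ne']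
    have : s q / q * N = (N / q : ℕ) * s q + (N % q : ℕ) * (s q / q) := by
      conv_lhs => rw [hN2]
      field_simp
    rw [this]
    ring
  have hd1 : s q / q ≤ 1 := div_le_one_of_le₀ (h1 q) hq'.le
  have hd0 : 0 ≤ s q / q := div_nonneg (h0 q) hq'.le
  rw [key, norm_div, Real.norm_eq_abs, Real.norm_of_nonneg hN'.le]
  gcongr
  refine abs_le.2 ⟨?_, ?_⟩
  · nlinarith [h0 (N % q), mul_le_mul_of_nonneg_left hd1 hr0]
  · nlinarith [h1 (N % q), mul_nonneg hr0 hd0]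

/-- A rational set of natural numbers is approximated by periodic sets. -/
lemma IsRationalNat.exists_periodic {J : Set ℕ} (hJ : IsRationalNat J) {ε : ℝ} (hε : 0 < ε) :
    ∃ (B : Set ℕ) (q : ℕ), 0 < q ∧ (∀ m, m ∈ B ↔ m % q ∈ B) ∧
      ∀ᶠ N in atTop, freq (symmDiff J B) N < ε := by
  obtain ⟨C, hC, rfl⟩ := hJ
  obtain ⟨B, hB, hd⟩ := hC ε hε
  obtain ⟨q, hq, hper⟩ := hB.exists_period
  refine ⟨natPart B, q, hq, hper, ?_⟩
  have : natPart (symmDiff C B) = symmDiff (natPart C) (natPart B) := rfl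
  rw [upperDensity_eq, this] at hd
  exact eventually_lt_of_limsup_lt hd (isBoundedUnder_le_freq _)

lemma IsRationalNat.exists_tendsto_freq {J : Set ℕ} (hJ : IsRationalNat J) :
    ∃ d, Tendsto (freq J) atTop (𝓝 d) := by
  refine cauchySeq_tendsto_of_complete (Metric.cauchySeq_iff.2 fun ε hε => ?_)
  obtain ⟨B, q, hq, hB, hJB⟩ := hJ.exists_periodic (ε := ε / 3) (by positivity)
  obtain ⟨d, hd⟩ := exists_tendsto_freq_of_periodic hq hB
  obtain ⟨N₀, hN₀⟩ := Metric.cauchySeq_iff.1 hd.cauchySeq (ε / 3) (by positivity)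
  obtain ⟨N₁, hN₁⟩ := eventually_atTop.1 hJB
  refine ⟨max N₀ N₁, fun m hm n hn => ?_⟩
  have h1 := hN₀ m (le_of_max_le_left hm) n (le_of_max_le_left hn)
  have h2 := (freq_symmDiff J B m).trans_lt (hN₁ m (le_of_max_le_right hm))
  have h3 := (freq_symmDiff J B n).trans_lt (hN₁ n (le_of_max_le_right hn))
  rw [Real.dist_eq, abs_lt] at *
  constructor <;> linarith

/-! ### Empirical measures and their limits -/

lemma refine_iterate {X ι : Type*} (f : X → X) (ξ : X → ι) (n : ℕ) (x : X) (i : ℕ) :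
    refine f ξ n (f^[i] x) = fun l : Fin n => ξ (f^[i + l] x) := by
  funext l
  rw [refine, ← Function.iterate_add_apply, add_comm]

section Empirical

variable {X : Type*} [MeasurableSpace X]

lemma empirical_real (f : X → X) (x : X) (N : ℕ+) {A : Set X} (hA : MeasurableSet A) :
    (empirical f x N).real A = freq {i | f^[i] x ∈ A} N := by
  classical
  have h : ∀ i, (Measure.dirac (f^[i] x)).real A =
      ({i | f^[i] x ∈ A} : Set ℕ).indicator (1 : ℕ → ℝ) i := fun i => by
    rw [measureReal_def, Measure.dirac_apply' _ hA]
    by_cases h : f^[i] x ∈ A <;> simp [h]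
  rw [empirical, measureReal_ennreal_smul_apply, measureReal_def, Measure.finsetSum_apply,
    ENNReal.toReal_sum fun i _ => measure_ne_top _ _, freq, ENNReal.toReal_inv,
    ENNReal.toReal_natCast, div_eq_inv_mul]
  exact congrArg _ (Finset.sum_congr rfl fun i _ => h i)

lemma partitionEntropy_empirical {κ : Type*} [Fintype κ] [MeasurableSpace κ]
    [MeasurableSingletonClass κ] (f : X → X) (x : X) (N : ℕ+) {ξ : X → κ} (hξ : Measurable ξ) :
    partitionEntropy (empirical f x N) ξ = seqEntropy (fun i => ξ (f^[i] x)) N := by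
  refine Finset.sum_congr rfl fun c _ => ?_
  rw [empirical_real f x N (hξ (measurableSet_singleton c))]
  rfl

lemma measurable_refine {ι : Type*} [MeasurableSpace ι] {f : X → X} (hf : Measurable f)
    {ξ : X → ι} (hξ : Measurable ξ) (n : ℕ) : Measurable (refine f ξ n) :=
  measurable_pi_lambda _ fun i => hξ.comp (hf.iterate i)

lemma integral_empirical [TopologicalSpace X] [OpensMeasurableSpace X] (f : X → X) (x : X)
    (N : ℕ+) (g : BoundedContinuousFunction X ℝ) :
    ∫ y, g y ∂(empirical f x N) = (∑ i ∈ Finset.range N, g (f^[i] x)) / (N : ℕ) := by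
  have hg : StronglyMeasurable g := g.continuous.measurable.stronglyMeasurable
  rw [empirical, integral_smul_measure, integral_finsetSum_measure]
  · simp only [integral_dirac' _ _ hg, ENNReal.toReal_inv, ENNReal.toReal_natCast, smul_eq_mul]
    rw [div_eq_inv_mul]
  · exact fun i _ => g.integrable _

/-- By the portmanteau theorem, null boundaries make the mass of each cell converge. -/
lemma tendsto_partitionEntropy [TopologicalSpace X] [OpensMeasurableSpace X]
    [HasOuterApproxClosed X] {κ : Type*} [Fintype κ] {μs : ℕ → ProbabilityMeasure X}
    {μ : ProbabilityMeasure X} (h : Tendsto μs atTop (𝓝 μ)) (ξ : X → κ)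
    (hξ : ∀ c, (μ : Measure X) (frontier (ξ ⁻¹' {c})) = 0) :
    Tendsto (fun k => partitionEntropy (μs k : Measure X) ξ) atTop
      (𝓝 (partitionEntropy (μ : Measure X) ξ)) := by
  refine tendsto_finsetSum _ fun c _ => (Real.continuous_negMulLog.tendsto _).comp ?_
  exact (ENNReal.tendsto_toReal (measure_ne_top _ _)).comp
    (ProbabilityMeasure.tendsto_measure_of_null_frontier_of_tendsto' h (hξ c))

/-- The boundary of a word cell lies in the union of the preimages under iterates of `f` of
boundaries of `ξ`-cells; these are null by invariance. -/
lemma measure_frontier_refine [TopologicalSpace X] [OpensMeasurableSpace X] {ι : Type*}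
    {f : X → X} (hf : Continuous f) {μ : Measure X} (hμ : MeasurePreserving f μ μ) {ξ : X → ι}
    (hξ : ∀ c, μ (frontier (ξ ⁻¹' {c})) = 0) (n : ℕ) (w : Fin n → ι) :
    μ (frontier (refine f ξ n ⁻¹' {w})) = 0 := by
  have hinter : ∀ s : Finset (Fin n),
      μ (frontier (⋂ i ∈ s, (fun x => ξ (f^[i] x)) ⁻¹' {w i})) = 0 := by
    classical
    intro s
    induction s using Finset.induction_on with
    | empty => simp
    | insert a s _ ih =>
      rw [Finset.set_biInter_insert]
      refine measure_mono_null (frontier_inter_subset _ _) (measure_union_null ?_ ?_)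
      · refine measure_mono_null Set.inter_subset_left ?_
        refine measure_mono_null ((hf.iterate a).frontier_preimage_subset (ξ ⁻¹' {w a})) ?_
        rw [(hμ.iterate a).measure_preimage isClosed_frontier.measurableSet.nullMeasurableSet]
        exact hξ _
      · exact measure_mono_null Set.inter_subset_right ih
  convert hinter Finset.univ using 3
  ext x
  simp [refine, funext_iff]

/-- Weak* limits of empirical measures along strictly increasing times are invariant. -/
lemma measurePreserving_of_tendsto_empiricalProb [TopologicalSpace X] [BorelSpace X]
    [HasOuterApproxClosed X] {f : X → X} (hf : Continuous f) {x : X} {n : ℕ → ℕ+}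
    (hn : StrictMono n) {ν : ProbabilityMeasure X}
    (h : Tendsto (fun k => empiricalProb f x (n k)) atTop (𝓝 ν)) :
    MeasurePreserving f (ν : Measure X) (ν : Measure X) := by
  have h1 := ProbabilityMeasure.tendsto_map_of_tendsto_of_continuous _ _ h hf
  have hn' : Tendsto (fun k => ((n k : ℕ) : ℝ)) atTop atTop :=
    tendsto_natCast_atTop_atTop.comp
      (StrictMono.tendsto_atTop fun a b hab => by exact_mod_cast hn hab)
  have h2 : Tendsto (fun k => (empiricalProb f x (n k)).map hf.measurable.aemeasurable) atTop
      (𝓝 ν) := by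
    rw [ProbabilityMeasure.tendsto_iff_forall_integral_tendsto] at h ⊢
    intro g
    -- Pushing forward by `f` telescopes: only the two end terms of the orbit sum change.
    have hdiff : Tendsto (fun k => (g (f^[n k] x) - g x) / (n k : ℕ)) atTop (𝓝 0) := by
      rw [tendsto_zero_iff_norm_tendsto_zero]
      refine squeeze_zero (fun _ => norm_nonneg _) (fun k => ?_)
        (hn'.const_div_atTop (2 * ‖g‖))
      rw [norm_div, Real.norm_natCast]
      gcongr
      calc _ ≤ ‖g (f^[n k] x)‖ + ‖g x‖ := norm_sub_le _ _
        _ ≤ 2 * ‖g‖ := by linarith [g.norm_coe_le_norm (f^[n k] x), g.norm_coe_le_norm x]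
    have := (h g).add hdiff
    rw [add_zero] at this
    refine this.congr fun k => ?_
    have hmap : ∫ y, g y ∂((empiricalProb f x (n k)).map hf.measurable.aemeasurable : Measure X) =
        ∫ y, (g.compContinuous ⟨f, hf⟩) y ∂(empirical f x (n k)) :=
      integral_map hf.measurable.aemeasurable g.continuous.measurable.aestronglyMeasurable
    have hcoe : ((empiricalProb f x (n k) : ProbabilityMeasure X) : Measure X) =
      empirical f x (n k) := rfl
    rw [hmap, hcoe, integral_empirical, integral_empirical, ← add_div]
    congr 1
    have hs : ∀ i, (g.compContinuous ⟨f, hf⟩) (f^[i] x) = g (f^[i + 1] x) := fun i => by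
      rw [Function.iterate_succ_apply']
      rfl
    simp only [hs]
    have e1 := Finset.sum_range_succ (fun i => g (f^[i] x)) (n k)
    have e2 := Finset.sum_range_succ' (fun i => g (f^[i] x)) (n k)
    simp only [Function.iterate_zero, id_eq] at e2
    linarith
  have := tendsto_nhds_unique h1 h2
  exact ⟨hf.measurable, congrArg Subtype.val this⟩

end Empirical

/-! ### Words of a generic point of the Bernoulli measure -/

lemma continuous_shift : Continuous shift :=
  continuous_pi fun i => continuous_apply (i + 1)

lemma shift_iterate_apply (z : ℤ → Fin 2) (i : ℕ) (j : ℤ) : shift^[i] z j = z (j + i) := by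
  induction i generalizing z with
  | zero => simp
  | succ i ih =>
    rw [Function.iterate_succ_apply, ih, shift]
    congr 1
    push_cast
    ring

lemma bernoulliHalf_word (n : ℕ) (w : Fin n → Fin 2) :
    (bernoulliHalf : Measure (ℤ → Fin 2)).real (refine shift (fun ω => ω 0) n ⁻¹' {w}) =
      (2⁻¹ : ℝ) ^ n := by
  let s : Finset ℤ := (Finset.range n).map Nat.castEmbedding
  -- Only sites in `s` matter; the value `0` elsewhere is arbitrary.
  let t : ℤ → Set (Fin 2) := fun i => {if h : i.toNat < n then w ⟨i.toNat, h⟩ else 0}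
  have h : refine shift (fun ω => ω 0) n ⁻¹' {w} = Set.pi s t := by
    ext ω
    simp only [Set.mem_preimage, Set.mem_singleton_iff, funext_iff, refine, shift_iterate_apply,
      zero_add, s, t, Set.mem_pi, Finset.coe_map, Set.mem_image, Finset.mem_coe, Finset.mem_range,
      Nat.castEmbedding_apply, forall_exists_index, and_imp, forall_apply_eq_imp_iff₂,
      Int.toNat_natCast]
    constructor
    · intro h i hi
      rw [dif_pos hi, ← h ⟨i, hi⟩]
    · intro h i
      rw [h i i.2, dif_pos i.2]
  have h3 : (bernoulliHalf : Measure (ℤ → Fin 2)) (Set.pi s t) = 2⁻¹ ^ n := by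
    change (Measure.infinitePi fun _ : ℤ => (PMF.uniformOfFintype (Fin 2)).toMeasure)
      (Set.pi s t) = _
    rw [Measure.infinitePi_pi _ fun i _ => measurableSet_singleton _]
    simp [s]
  rw [h, measureReal_def, h3]
  simp

lemma partitionEntropy_bernoulliHalf (n : ℕ) :
    partitionEntropy (bernoulliHalf : Measure (ℤ → Fin 2)) (refine shift (fun ω => ω 0) n) =
      n * Real.log 2 := by
  simp only [partitionEntropy, bernoulliHalf_word, Real.negMulLog, Real.log_pow, Real.log_inv,
    Finset.sum_const, Finset.card_univ, Fintype.card_fun, Fintype.card_fin, nsmul_eq_mul]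
  push_cast
  rw [inv_pow]
  field_simp

/-- Along some subsequence of any sequence of times, the entropies of the distributions of words
of a generic point converge to those of the Bernoulli measure. -/
lemma exists_subseq_tendsto_seqEntropy {z : ℤ → Fin 2}
    (hz : IsGenericPoint shift z bernoulliHalf) {N : ℕ → ℕ+} (hN : StrictMono N) :
    ∃ φ : ℕ → ℕ, StrictMono φ ∧ ∀ n : ℕ,
      Tendsto (fun k => seqEntropy (fun i (l : Fin n) => z ((i + l : ℕ) : ℤ)) (N (φ k))) atTop
        (𝓝 (n * Real.log 2)) := by
  -- Compactness supplies a limit; being invariant, it belongs to `generatedMeasures shift z`, which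
  -- is a singleton. The choice of `φ` precedes `n`.
  obtain ⟨ν, φ, hφ, hν⟩ := CompactSpace.tendsto_subseq fun k => empiricalProb shift z (N k)
  have hνz : ν ∈ generatedMeasures shift z :=
    ⟨measurePreserving_of_tendsto_empiricalProb continuous_shift (hN.comp hφ) hν, N ∘ φ,
      hN.comp hφ, hν⟩
  rw [IsGenericPoint] at hz
  obtain rfl : ν = bernoulliHalf := by rwa [hz] at hνz
  refine ⟨φ, hφ, fun n => ?_⟩
  have hfr : ∀ c : Fin 2, (bernoulliHalf : Measure (ℤ → Fin 2))
      (frontier ((fun ω : ℤ → Fin 2 => ω 0) ⁻¹' {c})) = 0 := fun c => by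
    have : IsClopen ((fun ω : ℤ → Fin 2 => ω 0) ⁻¹' {c}) :=
      (isClopen_discrete {c}).preimage (continuous_apply 0)
    rw [this.frontier_eq, measure_empty]
  rw [← partitionEntropy_bernoulliHalf]
  refine (tendsto_partitionEntropy hν _ (measure_frontier_refine continuous_shift hνz.1 hfr
    n)).congr fun k => ?_
  change partitionEntropy (empirical shift z (N (φ k))) _ = _
  rw [partitionEntropy_empirical _ _ _
    (measurable_refine continuous_shift.measurable (measurable_pi_apply 0) n)]
  simp only [refine_iterate, shift_iterate_apply, zero_add]

/-! ### The entropy bound -/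

/-- Disjoint compact sets are separated by a two-set partition with null boundary. -/
lemma exists_separating_partition {X : Type*} [MetricSpace X] [MeasurableSpace X] [BorelSpace X]
    (μ : Measure X) [SFinite μ] {K : Fin 2 → Set X} (hK : ∀ i, IsCompact (K i))
    (hdisj : Disjoint (K 0) (K 1)) :
    ∃ ξ : X → Fin 2, Measurable ξ ∧ (∀ i, ∀ x ∈ K i, ξ x = i) ∧
      ∀ c, μ (frontier (ξ ⁻¹' {c})) = 0 := by
  classical
  obtain ⟨δ, hδ, hd⟩ := hdisj.exists_thickenings (hK 0) (hK 1).isClosed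
  -- Some radius below `δ` has null frontier, and staying below `δ` keeps the thickening off `K 0`.
  obtain ⟨r, hr, hfr⟩ := exists_null_frontier_thickening μ (K 1) hδ
  set U := Metric.thickening r (K 1) with hU
  have hUm : MeasurableSet U := Metric.isOpen_thickening.measurableSet
  have hK1 : ∀ x ∈ K 1, x ∈ U := fun x hx => Metric.self_subset_thickening hr.1 _ hx
  have hK0 : ∀ x ∈ K 0, x ∉ U := fun x hx hxU =>
    Set.disjoint_left.1 hd (Metric.self_subset_thickening hδ _ hx)
      (Metric.thickening_mono hr.2.le _ hxU)
  refine ⟨fun x => if x ∈ U then 1 else 0,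
    Measurable.ite hUm measurable_const measurable_const, ?_, ?_⟩
  · intro i x hx
    match i with
    | 0 => simp [hK0 x hx]
    | 1 => simp [hK1 x hx]
  · intro c
    match c with
    | 0 =>
      have : (fun x => if x ∈ U then (1 : Fin 2) else 0) ⁻¹' {0} = Uᶜ := by
        ext x; by_cases h : x ∈ U <;> simp [h]
      rw [this, frontier_compl, hfr]
    | 1 =>
      have : (fun x => if x ∈ U then (1 : Fin 2) else 0) ⁻¹' {1} = U := by
        ext x; by_cases h : x ∈ U <;> simp [h]
      rw [this, hfr]

lemma le_entropyOfPartition {X ι : Type*} [MeasurableSpace X] [Fintype ι] (f : X → X)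
    (μ : Measure X) (ξ : X → ι) (c C : ℝ)
    (h : ∀ n : ℕ, n * c - C ≤ partitionEntropy μ (refine f ξ n)) :
    (c : EReal) ≤ entropyOfPartition f μ ξ := by
  have hlim : Tendsto (fun n : ℕ => ((c - C / n : ℝ) : EReal)) atTop (𝓝 (c : EReal)) := by
    refine EReal.tendsto_coe.2 ?_
    simpa using tendsto_const_nhds.sub (tendsto_const_div_atTop_nhds_zero_nat C)
  rw [← hlim.limsup_eq]
  refine limsup_le_limsup ?_
  filter_upwards [eventually_gt_atTop 0] with n hn
  have hn' : (0 : ℝ) < n := by exact_mod_cast hn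
  refine EReal.coe_le_coe_iff.2 ?_
  rw [le_div_iff₀ hn', sub_mul, div_mul_cancel₀ _ hn'.ne', mul_comm]
  exact h n

lemma exists_small_log_error {η : ℝ} (hη : 0 < η) :
    ∃ δ ε : ℝ, 0 < δ ∧ δ < 1 ∧ 0 < ε ∧ ε * (-Real.log δ) + (-Real.log (1 - δ)) ≤ η := by
  have hcont : Tendsto (fun δ : ℝ => -Real.log (1 - δ)) (𝓝[>] 0) (𝓝 0) := by
    have : ContinuousAt (fun δ : ℝ => -Real.log (1 - δ)) 0 :=
      ((continuousAt_const.sub continuousAt_id).log (by simp)).neg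
    have h := this.tendsto
    simp only [sub_zero, Real.log_one, neg_zero] at h
    exact h.mono_left nhdsWithin_le_nhds
  obtain ⟨δ, h1, h2, h3⟩ := ((hcont.eventually_lt_const (half_pos hη)).and
    ((eventually_lt_nhds one_pos).filter_mono nhdsWithin_le_nhds |>.and
      self_mem_nhdsWithin)).exists
  have h3 : 0 < δ := h3
  have hl : 0 < -Real.log δ := by linarith [Real.log_neg h3 h2]
  -- `δ` makes the second term less than `η / 2`; then `ε` makes the first equal to `η / 2`.
  refine ⟨δ, η / 2 / -Real.log δ, h3, h2, by positivity, ?_⟩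
  rw [div_mul_cancel₀ _ hl.ne']
  linarith

variable {X : Type*} [MetricSpace X] [MeasurableSpace X] [BorelSpace X]

/-- A partition whose labels along the orbit of `x` agree with a Bernoulli-generic sequence at the
times in a rational set of density `d` has entropy at least `d * log 2`. -/
lemma le_entropyOfPartition_of_isGenericPoint {J : Set ℕ} (hJ : IsRationalNat J) {d : ℝ}
    (hd : Tendsto (freq J) atTop (𝓝 d)) {f : X → X} (hf : Continuous f) {x : X} {z : ℤ → Fin 2}
    (hz : IsGenericPoint shift z bernoulliHalf) {μ : ProbabilityMeasure X}
    (hμ : μ ∈ generatedMeasures f x) {ξ : X → Fin 2} (hξ : Measurable ξ)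
    (hfr : ∀ c, (μ : Measure X) (frontier (ξ ⁻¹' {c})) = 0)
    (hξz : ∀ j ∈ J, ξ (f^[j] x) = z j) :
    ((d * Real.log 2 : ℝ) : EReal) ≤ entropyOfPartition f (μ : Measure X) ξ := by
  obtain ⟨hinv, N, hN, hlim⟩ := hμ
  obtain ⟨φ, hφ, hent⟩ := exists_subseq_tendsto_seqEntropy hz hN
  have hM : Tendsto (fun k => (N (φ k) : ℕ)) atTop atTop :=
    StrictMono.tendsto_atTop fun a b hab => by exact_mod_cast hN (hφ hab)
  refine EReal.ge_of_forall_gt_iff_ge.1 fun c hc => ?_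
  have hc : c < d * Real.log 2 := EReal.coe_lt_coe_iff.1 hc
  -- The slack `d * log 2 - c` fixes `δ` and `ε`, hence `B` and `q`, before `n`: the constant `log
  -- q` must not depend on `n`.
  obtain ⟨δ, ε, h0, h1, hε, hδε⟩ := exists_small_log_error (sub_pos.2 hc)
  obtain ⟨B, q, hq, hB, hJB⟩ := hJ.exists_periodic hε
  refine le_entropyOfPartition f μ ξ c (Real.log q) fun n => ?_
  have hpart : Tendsto
      (fun k => seqEntropy (fun i (l : Fin n) => ξ (f^[i + l] x)) (N (φ k))) atTop
      (𝓝 (partitionEntropy (μ : Measure X) (refine f ξ n))) := by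
    refine (tendsto_partitionEntropy (hlim.comp hφ.tendsto_atTop) _
      (measure_frontier_refine hf hinv hfr n)).congr fun k => ?_
    change partitionEntropy (empirical f x (N (φ k))) _ = _
    rw [partitionEntropy_empirical _ _ _ (measurable_refine hf.measurable hξ n)]
    simp only [refine_iterate]
  have hnN : Tendsto (fun k => (n : ℝ) / (N (φ k) : ℕ)) atTop (𝓝 0) :=
    (tendsto_const_div_atTop_nhds_zero_nat (n : ℝ)).comp hM
  have hrhs := (hpart.add_const (Real.log q)).add
    ((((((tendsto_const_nhds (x := (1 : ℝ))).sub (hd.comp hM)).add hnN).mul_const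
      (Real.log 2)).add (((tendsto_const_nhds (x := ε)).add hnN).mul_const (-Real.log δ))
      |>.add_const (-Real.log (1 - δ))).const_mul (n : ℝ))
  -- With `n` fixed and time going to infinity, the window errors `n / N` vanish and the frequency
  -- of `J` tends to `d`.
  have hle := le_of_tendsto_of_tendsto (hent n) hrhs <| by
    filter_upwards [hM.eventually hJB] with k hk
    refine (seqEntropy_words_le (fun i => z (i : ℤ)) (fun i => ξ (f^[i] x)) J B hξz hq hB h0 h1 n
      (N (φ k)).pos).trans ?_
    have hl : 0 ≤ -Real.log δ := by linarith [Real.log_neg h0 h1]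
    simp only [Function.comp_apply]
    gcongr
  have hn := mul_le_mul_of_nonneg_left hδε (n.cast_nonneg : (0 : ℝ) ≤ n)
  simp only [add_zero] at hle
  nlinarith

end

end EntropyControl

theorem corollary4 {X : Type*} [MetricSpace X] [CompactSpace X] [MeasurableSpace X] [BorelSpace X]
    (J : Set ℕ) (hJ : EntropyControl.IsRationalNat J) :
    ∃ d : ℝ, EntropyControl.HasDensity J d ∧
      ∀ (f : X → X), Continuous f →
      ∀ (K : Fin 2 → Set X), (∀ i, IsCompact (K i)) → Disjoint (K 0) (K 1) →
      ∀ (x : X) (z : ℤ → Fin 2), (∀ j ∈ J, f^[j] x ∈ K (z (j : ℤ))) →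
      EntropyControl.IsGenericPoint EntropyControl.shift z EntropyControl.bernoulliHalf →
      ∀ μ ∈ EntropyControl.generatedMeasures f x,
        ((d * Real.log 2 : ℝ) : EReal) ≤ EntropyControl.ksEntropy f (μ : MeasureTheory.Measure X) ∧
        (0 < d → 0 < EntropyControl.ksEntropy f (μ : MeasureTheory.Measure X)) := by
  obtain ⟨d, hd⟩ := hJ.exists_tendsto_freq
  refine ⟨d, EntropyControl.hasDensity_of_tendsto hd, ?_⟩
  intro f hf K hK hdisj x z hxz hz μ hμ
  obtain ⟨ξ, hξ, hξK, hfr⟩ :=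
    EntropyControl.exists_separating_partition (μ : MeasureTheory.Measure X) hK hdisj
  have hle : ((d * Real.log 2 : ℝ) : EReal) ≤
      EntropyControl.ksEntropy f (μ : MeasureTheory.Measure X) :=
    (EntropyControl.le_entropyOfPartition_of_isGenericPoint hJ hd hf hz hμ hξ hfr
      fun j hj => hξK _ _ (hxz j hj)).trans
      (le_iSup_of_le 2 (le_iSup_of_le ξ (le_iSup_of_le hξ le_rfl)))
  refine ⟨hle, fun hpos => lt_of_lt_of_le ?_ hle⟩
  exact EReal.coe_pos.2 (mul_pos hpos (Real.log_pos one_lt_two))
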